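/- A *spherical tangle diagram* $S$ is a planar diagram, with finitely many double points at which an over-strand and an under-strand are distinguished, of a 1-dimensional proper submanifold of $S^2\times[0,1]$ with four end points on each of the two boundary spheres; it is drawn in an annulus, with four end points NW, NE, SE, SW on each of the two boundary circles. A *closed component* of $S$ is a component without end points. For $i,j\in\{1,2\}$ let $S_{ij}$ be the link diagram obtained from $S$ as follows. Outside the annulus take the numerator closure if $i=1$ (join NW to NE and SW to SE by arcs without crossings), and the denominator closure if $i=2$ (join NW to SW and NE to SE). Fill the inner hole with the fundamental tangle $j$, which has no crossings and joins NW to SW and NE to SE if $j=1$, and NW to NE and SW to SE if $j=2$. For a link diagram $L$ let $$\langle L\rangle=\sum_{\sigma}A^{\alpha(\sigma)-\beta(\sigma)}(-A^2-A^{-2})^{d(\sigma)-1}$$ be its Kauffman bracket at $A=e^{i\pi/4}$. Here $\sigma$ runs over all states of $L$, that is, over all choices of an $A$-type or $B$-type splitting at each crossing; $\alpha(\sigma)$ and $\beta(\sigma)$ are the numbers of $A$-type and $B$-type splittings in $\sigma$, and $d(\sigma)$ is the number of circles of the resulting diagram. (The $A$-type splitting joins the two regions that are swept out when the over-strand is turned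 counterclockwise; the $B$-type splitting joins the other two.) The invariant $F(S)$ is the element $$F(S)=\left\{\begin{pmatrix} z\langle S_{11}\rangle & -iz\langle S_{12}\rangle\\ iz\langle S_{21}\rangle & z\langle S_{22}\rangle\end{pmatrix} : z\in\mathbb C,\ z^8=1\right\}\cap M_{2\times 2}(\mathbb Z)$$ of the set of integer $2\times2$ matrices modulo multiplication by $\pm1$; the class $\{M,-M\}$ is written $[M]$. **Theorem.** Let $S$ be a spherical tangle diagram with $F(S)=\left[\begin{matrix}\alpha&\gamma\\ \beta&\delta\end{matrix}\right]$. If $S$ has a closed component, then $\alpha$, $\beta$, $\gamma$, $\delta$ are all even. -/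

import Mathlib

/-!
Link diagrams and spherical tangle diagrams are encoded by their half-edges, in the style of
planar diagram codes: a diagram is a finite graph drawn on the sphere with its crossings as
4-valent vertices, and it is recorded by how half-edges are glued to edges and in which cyclic
order they leave each vertex.

* At each crossing the four half-edges are numbered `0, 1, 2, 3 : ZMod 4` counterclockwise, in such
  a way that `0` and `2` form the over-strand and `1` and `3` the under-strand.
* The curves may carry auxiliary bivalent vertices. They make it possible to have circles without
  crossings. The half-edges at bivalent vertices form the type `Point`, and `turn` exchanges the
  two half-edges of each bivalent vertex.
* `edge` sends a half-edge to the other half of the same edge.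
-/

/-- The number of equivalence classes of the equivalence relation generated by `r`. -/
noncomputable def numClasses {X : Type} (r : X → X → Prop) : ℕ := Nat.card (Quot r)

/-- The half-edges of a closed diagram with `n` crossings. -/
abbrev HalfEdge (n : ℕ) (Point : Type) : Type := (Fin n × ZMod 4) ⊕ Point

/-- A (combinatorial, unoriented) link diagram. Planarity is not recorded here, since the
Kauffman bracket is given by the same formula without it; it is part of the definition of a
spherical tangle diagram, and the closures of planar diagrams are planar. -/
structure LinkDiagram where
  /-- number of crossings -/
  n : ℕ
  /-- half-edges at bivalent vertices -/
  Point : Type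
  finite_point : Finite Point
  edge : HalfEdge n Point → HalfEdge n Point
  edge_invol : Function.Involutive edge
  edge_ne : ∀ x, edge x ≠ x
  turn : Point → Point
  turn_invol : Function.Involutive turn
  turn_ne : ∀ q, turn q ≠ q

namespace LinkDiagram

/-- A state chooses a splitting at each crossing: `true` is the `A`-type splitting, `false` the
`B`-type splitting. -/
abbrev State (L : LinkDiagram) : Type := Fin L.n → Bool

/-- How the half-edges at a vertex are connected after applying a state. Turning the over-strand
`0 – 2` counterclockwise sweeps out the regions between `0` and `1` and between `2` and `3`, which
are therefore the `A`-regions. The `A`-type splitting opens a channel between them, and hence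
connects `1` with `2` and `3` with `0`; the `B`-type splitting connects `0` with `1` and `2`
with `3`. -/
def split (L : LinkDiagram) (σ : L.State) : HalfEdge L.n L.Point → HalfEdge L.n L.Point
  | .inl (c, k) => .inl (c, if σ c then 3 - k else 1 - k)
  | .inr q => .inr (L.turn q)

/-- `d(σ)`, the number of circles of the diagram `L_σ`. -/
noncomputable def numCircles (L : LinkDiagram) (σ : L.State) : ℕ :=
  numClasses fun x y => y = L.edge x ∨ y = L.split σ x

/-- The Kauffman bracket `⟨L⟩` at the complex number `A`. -/
noncomputable def bracket (L : LinkDiagram) (A : ℂ) : ℂ :=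
  ∑ σ : L.State,
    A ^ (Finset.univ.filter fun c => σ c = true).card *
      A⁻¹ ^ (Finset.univ.filter fun c => σ c = false).card *
      (-A ^ 2 - A⁻¹ ^ 2) ^ ((L.numCircles σ : ℤ) - 1)

/-- The Kauffman bracket at `A = e^{iπ/4}`. -/
noncomputable def bracket₈ (L : LinkDiagram) : ℂ :=
  L.bracket (Complex.exp (Complex.I * Real.pi / 4))

end LinkDiagram

/-- The half-edges of a diagram with `n` crossings in an annulus which has four end points on each
of its two boundary circles. The pair `(h, k) : Fin 2 × ZMod 4` is the half-edge at the `k`-th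
end point of the outer boundary circle for `h = 0`, of the inner boundary circle for `h = 1`. -/
abbrev TangleHalfEdge (n : ℕ) (Point : Type) : Type :=
  HalfEdge n (Point ⊕ (Fin 2 × ZMod 4))

/-- The next half-edge counterclockwise at the same vertex. The complement of the annulus in the
sphere is regarded as two 4-valent vertices. -/
def TangleHalfEdge.rotate {n : ℕ} {Point : Type} (turn : Point → Point) :
    TangleHalfEdge n Point → TangleHalfEdge n Point
  | .inl (c, k) => .inl (c, k + 1)
  | .inr (.inl q) => .inr (.inl (turn q))
  | .inr (.inr (h, k)) => .inr (.inr (h, k + 1))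

/-- A spherical tangle diagram: the diagram of a 1-punctured ball tangle with four end points on
each boundary sphere.

The four end points are numbered counterclockwise around the complementary disc of the sphere
which they bound. Thus on the inner circle `0, 1, 2, 3` are the points NW, SW, SE, NE. The outer
circle bounds the outside disc around infinity, so that on it `0, 1, 2, 3` are the points
NW, NE, SE, SW.

The last condition is Euler's formula: it says that each connected component of the graph,
in which the two complementary discs of the annulus are shrunk to vertices, is drawn on a sphere.
The position of the different connected components of the graph relative to each other is not
recorded; the Kauffman brackets do not depend on it. -/
structure SphericalTangleDiagram where
  /-- number of crossings -/
  n : ℕ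
  /-- half-edges at bivalent vertices -/
  Point : Type
  finite_point : Finite Point
  edge : TangleHalfEdge n Point → TangleHalfEdge n Point
  edge_invol : Function.Involutive edge
  edge_ne : ∀ x, edge x ≠ x
  turn : Point → Point
  turn_invol : Function.Involutive turn
  turn_ne : ∀ q, turn q ≠ q
  /-- vertices + faces = edges + 2 * components -/
  planar :
    numClasses (fun x y : TangleHalfEdge n Point => y = TangleHalfEdge.rotate turn x) +
      numClasses (fun x y : TangleHalfEdge n Point => y = TangleHalfEdge.rotate turn (edge x)) =
    numClasses (fun x y : TangleHalfEdge n Point => y = edge x) +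
      2 * numClasses (fun x y : TangleHalfEdge n Point => y = edge x ∨ y = TangleHalfEdge.rotate turn x)

namespace SphericalTangleDiagram

/-- The connections made in the complementary discs of the annulus. The indices `0, 1 : Fin 2`
stand for the subscripts `1` and `2`.

Outer disc: the numerator closure (`i = 0`) connects NW with NE and SE with SW; the denominator
closure (`i = 1`) connects NW with SW and NE with SE.

Inner disc: the fundamental tangle 1 (`j = 0`) connects NW with SW and SE with NE; the fundamental
tangle 2 (`j = 1`) connects NW with NE and SW with SE.

With the numbering of the end points, in all cases index `0` connects `0` with `1` and `2` with
`3`, and index `1` connects `0` with `3` and `1` with `2`. -/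
def cap (i j : Fin 2) : Fin 2 × ZMod 4 → Fin 2 × ZMod 4
  | (h, k) => (h, if (if h = 0 then i else j) = 0 then 1 - k else 3 - k)

theorem cap_invol (i j : Fin 2) : Function.Involutive (cap i j) := by
  revert i j; unfold Function.Involutive; decide

theorem cap_ne (i j : Fin 2) : ∀ q, cap i j q ≠ q := by
  revert i j; decide

/-- The link diagram `S_ij`: the numerator or denominator closure of `S`, with its hole filled by
one of the two fundamental tangles. -/
def closure (S : SphericalTangleDiagram) (i j : Fin 2) : LinkDiagram where
  n := S.n
  Point := S.Point ⊕ (Fin 2 × ZMod 4)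
  finite_point := haveI := S.finite_point; Finite.instSum
  edge := S.edge
  edge_invol := S.edge_invol
  edge_ne := S.edge_ne
  turn := Sum.map S.turn (cap i j)
  turn_invol := by
    rintro (q | q)
    · exact congrArg Sum.inl (S.turn_invol q)
    · exact congrArg Sum.inr (cap_invol i j q)
  turn_ne := by
    rintro (q | q) h
    · exact S.turn_ne q (Sum.inl_injective h)
    · exact cap_ne i j q (Sum.inr_injective h)

/-- The matrix `X(S)` of Kauffman brackets from which the invariant is obtained. -/
noncomputable def bracketMatrix (S : SphericalTangleDiagram) : Matrix (Fin 2) (Fin 2) ℂ :=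
  !![(S.closure 0 0).bracket₈, -Complex.I * (S.closure 0 1).bracket₈;
     Complex.I * (S.closure 1 0).bracket₈, -Complex.I * Complex.I * (S.closure 1 1).bracket₈]

/-- The invariant `F(S) = {z X(S) | z ∈ Φ} ∩ M₂ₓ₂(ℤ)`, where `Φ` is the set of 8th roots of unity.
It is an element `[M] = {M, -M}` of the set `PM₂ₓ₂(ℤ)` of integer matrices modulo sign. -/
def F (S : SphericalTangleDiagram) : Set (Matrix (Fin 2) (Fin 2) ℤ) :=
  {M | ∃ z : ℂ, z ^ 8 = 1 ∧ M.map (Int.cast : ℤ → ℂ) = z • S.bracketMatrix}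

/-- `x` and `y` are neighbours on a strand: they belong to the same edge, or they are opposite at a
crossing, or they belong to the same bivalent vertex. -/
def StrandNext (S : SphericalTangleDiagram) (x y : TangleHalfEdge S.n S.Point) : Prop :=
  y = S.edge x ∨
    (∃ c k, x = .inl (c, k) ∧ y = .inl (c, k + 2)) ∨
    (∃ q, x = .inr (.inl q) ∧ y = .inr (.inl (S.turn q)))

/-- `S` has a closed component: some component of the tangle has no end point on the
boundary. The components are the classes of the equivalence relation generated by
`StrandNext`. -/
def HasClosedComponent (S : SphericalTangleDiagram) : Prop :=
  ∃ x, ∀ (h : Fin 2) (k : ZMod 4), ¬ Relation.EqvGen S.StrandNext x (.inr (.inr (h, k)))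

end SphericalTangleDiagram

/-! At `A = e^{iπ/4}` the loop value `-A² - A⁻²` is `-i + i = 0`, so only states with a single
circle contribute to the bracket, each an eighth root of unity. Modulo the prime above 2 every such
root is 1; an integer entry of the matrix thus has the parity of the number of single-circle states
(`intCast_eq_card_of_sum_rootsOfUnity`).

To find that parity, a third way to resolve a crossing is allowed: joining opposite half-edges. With
the rest of the diagram fixed, an even number of the three resolutions gives a single circle
(`sum_pairing_connected`). Modulo 2 the two splittings at a crossing may therefore be traded for the
third pairing. Doing this at all crossings leaves the strands themselves: the count is odd exactly
when the link has one component (`card_single_circle_states`). A closed component of `S` never meets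
the caps, so every closure has at least two components. -/

open Relation Function

/-! ### Orbits of two involutions: paths and circles -/

section Involutions

variable {X : Type}

/-- `x` and `y` are exchanged by one of the two maps. -/
def Linked (e s : X → X) (x y : X) : Prop := y = e x ∨ y = s x

theorem EqvGen.mem_iff {r : X → X → Prop} {C : X → Prop} (h : ∀ x y, r x y → (C x ↔ C y))
    {x y : X} (hxy : EqvGen r x y) : C x ↔ C y := by
  induction hxy with
  | rel x y hr => exact h x y hr
  | refl x => rfl
  | symm x y _ ih => exact ih.symm
  | trans x y z _ _ ih₁ ih₂ => exact ih₁.trans ih₂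

/-- A set which is mapped into itself by two involutions is a union of classes. -/
theorem Linked.mem_iff {e s : X → X} (he : Involutive e) (hs : Involutive s) {C : X → Prop}
    (hCe : ∀ x, C x → C (e x)) (hCs : ∀ x, C x → C (s x)) {x y : X}
    (hxy : EqvGen (Linked e s) x y) : C x ↔ C y := by
  refine EqvGen.mem_iff ?_ hxy
  rintro x y (rfl | rfl)
  · exact ⟨hCe x, fun h => by simpa [he x] using hCe _ h⟩
  · exact ⟨hCs x, fun h => by simpa [hs x] using hCs _ h⟩

theorem numClasses_eq_one_iff [Nonempty X] (r : X → X → Prop) :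
    numClasses r = 1 ↔ ∀ x y, EqvGen r x y := by
  rw [numClasses, Nat.card_eq_one_iff_unique]
  constructor
  · rintro ⟨h, -⟩ x y
    exact Quot.eqvGen_exact (h.elim (Quot.mk r x) (Quot.mk r y))
  · intro h
    refine ⟨⟨?_⟩, ⟨Quot.mk r (Classical.arbitrary X)⟩⟩
    rintro ⟨x⟩ ⟨y⟩
    exact Quot.eqvGen_sound (h x y)

/-- A class of two involutions, the first of which has no fixed points, which contains a fixed
point of the second one contains exactly two of them: it is a path with two ends. -/
theorem exists_unique_other_end [Finite X] {e s : X → X} (he : Involutive e)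
    (he' : ∀ x, e x ≠ x) (hs : Involutive s) {x : X} (hx : s x = x) :
    ∃ y, y ≠ x ∧ s y = y ∧ EqvGen (Linked e s) x y ∧
      ∀ z, s z = z → EqvGen (Linked e s) x z → z = x ∨ z = y := by
  set E : Equiv.Perm X := he.toPerm
  set S : Equiv.Perm X := hs.toPerm
  have hE : E * E = 1 := Equiv.ext he
  have hS : S * S = 1 := Equiv.ext hs
  have hEi : E⁻¹ = E := inv_eq_of_mul_eq_one_left hE
  have hSi : S⁻¹ = S := inv_eq_of_mul_eq_one_left hS
  -- Dihedral picture: both involutions conjugate `r` to its inverse. Since `s` fixes `x`, on the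
  -- points `r ^ i x` they act by `i ↦ -i` (for `s`) and `i ↦ -i - 1` (for `e`), so the class of `x`
  -- is its `r`-orbit.
  set r : Equiv.Perm X := S * E with hr
  have hri : r⁻¹ = E * S := by rw [hr, mul_inv_rev, hEi, hSi]
  have hconjS : S * r * S⁻¹ = r⁻¹ := by
    rw [hri, hSi, hr, ← mul_assoc, hS, one_mul]
  have hconjE : E * r * E⁻¹ = r⁻¹ := by
    rw [hri, hEi, hr, mul_assoc, mul_assoc, hE, mul_one]
  have hSr : ∀ i : ℤ, s ((r ^ i) x) = (r ^ (-i)) x := fun i => by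
    have h : S * r ^ i = r ^ (-i) * S := by
      rw [zpow_neg, ← inv_zpow, ← hconjS, conj_zpow]; group
    have := congrArg (fun f : Equiv.Perm X => f x) h
    simp only [Equiv.Perm.mul_apply] at this
    rw [show S x = x from hx] at this
    exact this
  have hEr : ∀ i : ℤ, e ((r ^ i) x) = (r ^ (-i - 1)) x := fun i => by
    have h : E * r ^ i = r ^ (-i - 1) * S := by
      have h₁ : E * r ^ i = r ^ (-i) * E := by
        rw [zpow_neg, ← inv_zpow, ← hconjE, conj_zpow]; group
      rw [h₁, zpow_sub_one, hri, mul_assoc, mul_assoc, hS, mul_one]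
    have := congrArg (fun f : Equiv.Perm X => f x) h
    simp only [Equiv.Perm.mul_apply] at this
    rw [show S x = x from hx] at this
    exact this
  have hstep : ∀ y, EqvGen (Linked e s) y (r y) := fun y =>
    .trans _ _ _ (.rel _ _ (.inl rfl)) (.rel _ (s (e y)) (.inr rfl))
  have hconn : ∀ i : ℕ, EqvGen (Linked e s) x ((r ^ i) x) := fun i => by
    induction i with
    | zero => exact .refl _
    | succ i ih =>
      rw [pow_succ', Equiv.Perm.mul_apply]
      exact .trans _ _ _ ih (hstep _)
  have hclass : ∀ z, EqvGen (Linked e s) x z → ∃ i : ℤ, z = (r ^ i) x := fun z hz =>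
    (Linked.mem_iff he hs (C := fun z => ∃ i : ℤ, z = (r ^ i) x)
      (by rintro _ ⟨i, rfl⟩; exact ⟨_, hEr i⟩) (by rintro _ ⟨i, rfl⟩; exact ⟨_, hSr i⟩) hz).1
      ⟨0, rfl⟩
  obtain ⟨m, hm, hm0⟩ : ∃ m : ℕ, (∀ i : ℤ, (r ^ i) x = x ↔ (m : ℤ) ∣ i) ∧ 0 < m := by
    refine ⟨minimalPeriod (r • ·) x, fun i => MulAction.zpow_smul_eq_iff_minimalPeriod_dvd (a := r), ?_⟩
    exact minimalPeriod_pos_of_mem_periodicPts (r.injective.mem_periodicPts x)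
  have hm' : ∀ i j : ℤ, (r ^ i) x = (r ^ j) x ↔ (m : ℤ) ∣ i - j := fun i j => by
    rw [← hm, sub_eq_neg_add, zpow_add, Equiv.Perm.mul_apply, zpow_neg, Equiv.Perm.inv_eq_iff_eq]
  obtain ⟨h, hh⟩ : ∃ h : ℕ, m = 2 * h := by
    rcases Nat.even_or_odd' m with ⟨h, hh | hh⟩
    · exact ⟨h, hh⟩
    · exfalso
      -- For an odd period `2h + 1`, the reflection `i ↦ -i - 1` would fix `i = h`, giving a fixed
      -- point of `e`.
      refine he' _ ((hEr h).trans ((hm' _ _).2 ?_))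
      rw [hh]
      exact ⟨-1, by push_cast; ring⟩
  subst hh
  -- The point `r ^ i x` is fixed by `s` iff `2h ∣ 2i`; modulo the period `2h` this leaves `i = 0`
  -- and `i = h`.
  refine ⟨(r ^ (h : ℤ)) x, ?_, ?_, ?_, ?_⟩
  · rw [Ne, hm]
    intro hd
    have := Int.le_of_dvd (by omega) hd
    push_cast at this
    omega
  · rw [hSr, hm']
    exact ⟨-1, by push_cast; ring⟩
  · rw [zpow_natCast]; exact hconn h
  · intro z hz hxz
    obtain ⟨i, rfl⟩ := hclass z hxz
    rw [hSr, hm'] at hz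
    obtain ⟨q, hq⟩ := hz
    rw [hm, hm']
    rcases Int.even_or_odd' q with ⟨p, rfl | rfl⟩
    · left
      refine ⟨-p, ?_⟩
      push_cast at hq ⊢
      linarith
    · right
      refine ⟨-p - 1, ?_⟩
      push_cast at hq ⊢
      linarith

end Involutions

/-! ### Pairings at a crossing and parity of single-circle states -/

section Pairings

/-- The three pairings of the four half-edges at a crossing: the `A`-type splitting, the `B`-type
splitting, and the pairing of opposite half-edges. -/
def pairing (t : Fin 3) (k : ZMod 4) : ZMod 4 :=
  if t = 0 then 3 - k else if t = 1 then 1 - k else k + 2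

theorem pairing_invol (t : Fin 3) : Involutive (pairing t) := by
  revert t; unfold Involutive; decide

theorem pairing_ne : ∀ t k, pairing t k ≠ k := by decide

/-- Four points have only three perfect matchings. -/
theorem exists_eq_pairing {p : ZMod 4 → ZMod 4} (hp : ∀ k, p k ≠ k) (hp' : Involutive p) :
    ∃ t, p = pairing t := by
  -- Encoding the map by its four values turns the claim into a finite check.
  let f (a b c d k : ZMod 4) : ZMod 4 := if k = 0 then a else if k = 1 then b else
    if k = 2 then c else d
  have key : ∀ a b c d : ZMod 4, (∀ k, f a b c d k ≠ k) →
      (∀ k, f a b c d (f a b c d k) = k) → ∃ t, ∀ k, f a b c d k = pairing t k := by decide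
  have hpf : f (p 0) (p 1) (p 2) (p 3) = p := by
    funext k; fin_cases k <;> rfl
  obtain ⟨t, ht⟩ := key (p 0) (p 1) (p 2) (p 3) (by rwa [hpf]) (by rwa [hpf])
  exact ⟨t, funext fun k => by rw [← ht, hpf]⟩

/-- The three pairings are the nontrivial elements of a Klein four-group acting simply transitively
on the four ends, and any two of them generate it. -/
theorem pairing_generate : ∀ t u : Fin 3, t ≠ u → ∀ k l : ZMod 4,
    l = k ∨ l = pairing t k ∨ l = pairing u k ∨ l = pairing u (pairing t k) := by decide

theorem pairing_exists_other : ∀ t : Fin 3, ∃ k, k ≠ 0 ∧ k ≠ pairing t 0 := by decide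

variable {X : Type}

open Classical in
/-- Of the three ways to pair up four loose ends, an even number gives a single circle. -/
theorem sum_pairing_connected [Finite X] {e : X → X} (he : Involutive e) (he' : ∀ x, e x ≠ x)
    {a : ZMod 4 → X} (ha : Injective a) {s : Fin 3 → X → X} (hs : ∀ t, Involutive (s t))
    (hs' : ∀ t x, s t x ≠ x) (hsa : ∀ t k, s t (a k) = a (pairing t k))
    (hso : ∀ t u x, x ∉ Set.range a → s t x = s u x) :
    ∑ t, (if numClasses (Linked e (s t)) = 1 then 1 else 0 : ZMod 2) = 0 := by
  have : Nonempty X := ⟨a 0⟩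
  simp only [numClasses_eq_one_iff]
  -- `f` cuts the crossing open: the four half-edges `a k` become its fixed points, that is, the
  -- loose ends of paths.
  set f : X → X := fun x => if x ∈ Set.range a then x else s 0 x
  have hfa : ∀ k, f (a k) = a k := fun k => if_pos ⟨k, rfl⟩
  have hfo : ∀ t x, x ∉ Set.range a → f x = s t x := fun t x hx =>
    (if_neg hx).trans (hso 0 t x hx)
  have hfinv : Involutive f := fun x => by
    by_cases hx : x ∈ Set.range a
    · obtain ⟨k, rfl⟩ := hx; rw [hfa, hfa]
    · have : s 0 x ∉ Set.range a := by
        rintro ⟨k, hk⟩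
        refine hx ⟨pairing 0 k, ?_⟩
        rw [← hsa, hk, hs]
      rw [hfo 0 x hx, hfo 0 _ this, hs]
  have hfix : ∀ x, f x = x → x ∈ Set.range a := fun x hx => by
    by_contra h
    exact hs' 0 x ((hfo 0 x h).symm.trans hx)
  have hpart : ∀ k, ∃ l, l ≠ k ∧ EqvGen (Linked e f) (a k) (a l) ∧
      ∀ j, EqvGen (Linked e f) (a k) (a j) → j = k ∨ j = l := fun k => by
    obtain ⟨y, hy, hfy, hky, huniq⟩ := exists_unique_other_end he he' hfinv (hfa k)
    obtain ⟨l, rfl⟩ := hfix y hfy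
    exact ⟨l, fun h => hy (by rw [h]), hky, fun j hj =>
      (huniq _ (hfa j) hj).imp (fun h => ha h) (fun h => ha h)⟩
  -- The paths outside the crossing match the four ends in pairs, so this matching is one of the
  -- three pairings, `u`.
  choose p hp hpR hpu using hpart
  have hpinv : Involutive p := fun k =>
    ((hpu (p k) k (.symm _ _ (hpR k))).resolve_left (hp k).symm).symm
  obtain ⟨u, rfl⟩ := exists_eq_pairing hp hpinv
  -- Closing up by `u` itself closes each of the two paths separately, so at least two circles
  -- arise.
  have hu : ¬ ∀ x y, EqvGen (Linked e (s u)) x y := fun h => by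
    obtain ⟨k, hk0, hk1⟩ := pairing_exists_other u
    have := (Linked.mem_iff he (hs u) (C := fun x => EqvGen (Linked e f) (a 0) x)
      (fun x hx => .trans _ _ _ hx (.rel _ _ (.inl rfl))) (fun x hx => by
        by_cases hxa : x ∈ Set.range a
        · obtain ⟨j, rfl⟩ := hxa
          rw [hsa]
          exact .trans _ _ _ hx (hpR j)
        · rw [← hfo u x hxa]
          exact .trans _ _ _ hx (.rel _ _ (.inr rfl))) (h (a 0) (a k))).1 (.refl _)
    exact (hpu 0 k this).elim hk0 hk1
  -- Either of the other two pairings joins both paths into one circle; it is the only one iff the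
  -- cut-open diagram has no circle away from the four ends. This condition does not involve `t`.
  have ht : ∀ t, t ≠ u → ((∀ x y, EqvGen (Linked e (s t)) x y) ↔
      ∀ x, ∃ k, EqvGen (Linked e f) x (a k)) := fun t htu => by
    constructor
    · intro h x
      by_contra! hx
      refine hx 0 ((Linked.mem_iff he (hs t) (C := fun y => EqvGen (Linked e f) x y)
        (fun y hy => .trans _ _ _ hy (.rel _ _ (.inl rfl))) (fun y hy => ?_) (h x (a 0))).1
        (.refl _))
      by_cases hya : y ∈ Set.range a
      · obtain ⟨j, rfl⟩ := hya
        exact absurd hy (hx j)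
      · rw [← hfo t y hya]
        exact .trans _ _ _ hy (.rel _ _ (.inr rfl))
    · intro h
      have hle : ∀ x y, EqvGen (Linked e f) x y → EqvGen (Linked e (s t)) x y := fun x y hxy => by
        refine (EqvGen.mem_iff (C := fun y => EqvGen (Linked e (s t)) x y) ?_ hxy).1 (.refl _)
        have hl : ∀ y z, Linked e f y z → EqvGen (Linked e (s t)) y z := by
          rintro y z (rfl | rfl)
          · exact .rel _ _ (.inl rfl)
          · by_cases hya : y ∈ Set.range a
            · obtain ⟨j, rfl⟩ := hya
              rw [hfa]
              exact .refl _
            · exact .rel _ _ (.inr (hfo t y hya))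
        exact fun y z hyz => ⟨fun hy => .trans _ _ _ hy (hl y z hyz),
          fun hz => .trans _ _ _ hz (.symm _ _ (hl y z hyz))⟩
      have hat : ∀ k, EqvGen (Linked e (s t)) (a k) (a (pairing t k)) := fun k =>
        .rel _ _ (.inr (hsa t k).symm)
      have hau : ∀ k, EqvGen (Linked e (s t)) (a k) (a (pairing u k)) := fun k => hle _ _ (hpR k)
      have haa : ∀ k l, EqvGen (Linked e (s t)) (a k) (a l) := fun k l => by
        rcases pairing_generate t u htu k l with rfl | rfl | rfl | rfl
        · exact .refl _
        · exact hat k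
        · exact hau k
        · exact .trans _ _ _ (hat k) (hau _)
      intro x y
      obtain ⟨k, hk⟩ := h x
      obtain ⟨l, hl⟩ := h y
      exact .trans _ _ _ (hle _ _ hk) (.trans _ _ _ (haa k l) (.symm _ _ (hle _ _ hl)))
  -- The term of `u` vanishes and the two others are equal, so they cancel modulo 2.
  rw [← Finset.add_sum_erase _ _ (Finset.mem_univ u), if_neg hu, zero_add,
    Finset.sum_congr rfl fun t htu => by rw [if_congr (ht t (Finset.ne_of_mem_erase htu)) rfl rfl],
    Finset.sum_const, Finset.card_erase_of_mem (Finset.mem_univ u)]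
  exact (nsmul_eq_mul _ _).trans (by simp [show (2 : ZMod 2) = 0 from rfl])

/-- If the three values at each place add up to zero, the sum over the first two values at every
place is the value at the third. -/
theorem sum_bool_eq_of_sum_three {n : ℕ} (P : (Fin n → Fin 3) → ZMod 2)
    (hP : ∀ (τ : Fin n → Fin 3) (c : Fin n), ∑ t, P (update τ c t) = 0) :
    ∑ σ : Fin n → Bool, P (fun c => if σ c then 0 else 1) = P (fun _ => 2) := by
  induction n with
  | zero =>
    rw [Fintype.sum_unique]
    exact congrArg P (Subsingleton.elim _ _)
  | succ n ih =>
    have hcons : ∀ (b : Bool) (σ : Fin n → Bool),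
        (fun c => if (Fin.cons b σ : Fin (n + 1) → Bool) c then (0 : Fin 3) else 1) =
          Fin.cons (if b then 0 else 1) fun c => if σ c then (0 : Fin 3) else 1 := fun b σ => by
      funext c
      refine Fin.cases ?_ (fun c => ?_) c <;> simp
    have htail : ∀ t : Fin 3, ∑ σ : Fin n → Bool,
        P (Fin.cons t fun c => if σ c then (0 : Fin 3) else 1) = P (Fin.cons t fun _ => 2) :=
      fun t => ih (fun τ => P (Fin.cons t τ)) fun τ c => by
        simpa only [Fin.cons_update] using hP (Fin.cons t τ) c.succ
    rw [← (Fin.consEquiv fun _ => Bool).sum_comp, Fintype.sum_prod_type]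
    simp only [Fin.consEquiv_apply, hcons, Fintype.sum_bool, htail]
    -- By induction all later places already carry the value 2; the relation at place 0 removes the
    -- last choice.
    have h := hP (Fin.cons 0 fun _ => 2) 0
    simp only [Fin.update_cons_zero, Fin.sum_univ_three] at h
    have h2 : (Fin.cons 2 fun _ => 2 : Fin (n + 1) → Fin 3) = fun _ => 2 := by
      funext c
      refine Fin.cases ?_ (fun c => ?_) c <;> simp
    rw [h2] at h
    simpa [CharTwo.neg_eq] using eq_neg_of_add_eq_zero_left h

end Pairings

/-! ### Integer sums of eighth roots of unity modulo 2 -/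

section RootsOfUnity

/-- An integer which is a sum of `N` eighth roots of unity is congruent to `N` modulo `2`. -/
theorem intCast_eq_card_of_sum_rootsOfUnity {ι : Type*} (s : Finset ι) (u : ι → ℂ)
    (hu : ∀ i ∈ s, u i ^ 8 = 1) (m : ℤ) (hm : (m : ℂ) = ∑ i ∈ s, u i) :
    (m : ZMod 2) = s.card := by
  obtain ⟨ζ, hζ⟩ : ∃ ζ : ℂ, IsPrimitiveRoot ζ 8 :=
    ⟨_, Complex.isPrimitiveRoot_exp 8 (by norm_num)⟩
  have hk : ∀ i, ∃ k : ℕ, i ∈ s → ζ ^ k = u i := fun i => by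
    by_cases hi : i ∈ s
    · obtain ⟨k, -, hk⟩ := hζ.eq_pow_of_pow_eq_one (hu i hi)
      exact ⟨k, fun _ => hk⟩
    · exact ⟨0, fun h => absurd h hi⟩
  choose k hk using hk
  -- `p` vanishes at `ζ`, so `Φ₈` divides it. Evaluating at 1, where `Φ₈(1) = 2`, makes `p(1)`, the
  -- number of terms minus `m`, even.
  let p : Polynomial ℤ := ∑ i ∈ s, Polynomial.X ^ k i - Polynomial.C m
  have hp : Polynomial.aeval ζ p = 0 := by
    simp only [p, map_sub, map_sum, map_pow, Polynomial.aeval_X, Polynomial.aeval_C]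
    rw [Finset.sum_congr rfl hk, ← hm]
    simp
  have hdvd : Polynomial.cyclotomic 8 ℤ ∣ p := by
    rw [Polynomial.cyclotomic_eq_minpoly hζ (by norm_num)]
    exact minpoly.isIntegrallyClosed_dvd (hζ.isIntegral (by norm_num)) hp
  obtain ⟨q, hq⟩ := hdvd
  have h1 := congrArg (Polynomial.eval 1) hq
  have : Fact (Nat.Prime 2) := ⟨Nat.prime_two⟩
  rw [Polynomial.eval_mul, show 8 = 2 ^ (2 + 1) by norm_num,
    Polynomial.eval_one_cyclotomic_prime_pow] at h1
  simp only [p, Polynomial.eval_sub, Polynomial.eval_finsetSum, Polynomial.eval_pow,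
    Polynomial.eval_X, one_pow, Polynomial.eval_C, Finset.sum_const, nsmul_eq_mul, mul_one] at h1
  have h2 := congrArg (Int.cast : ℤ → ZMod 2) h1
  push_cast at h2
  rw [show (2 : ZMod 2) = 0 from rfl, zero_mul] at h2
  exact (sub_eq_zero.1 h2).symm

end RootsOfUnity

/-! ### The Kauffman bracket at `e^{iπ/4}` and the number of components -/

namespace LinkDiagram

variable (L : LinkDiagram)

/-- The connections at the vertices when each crossing is replaced by one of the three pairings
of its half-edges. -/
def smoothing (τ : Fin L.n → Fin 3) : HalfEdge L.n L.Point → HalfEdge L.n L.Point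
  | .inl (c, k) => .inl (c, pairing (τ c) k)
  | .inr q => .inr (L.turn q)

theorem smoothing_invol (τ : Fin L.n → Fin 3) : Involutive (L.smoothing τ) := by
  rintro (⟨c, k⟩ | q)
  · simp only [smoothing, pairing_invol (τ c) k]
  · simp only [smoothing, L.turn_invol q]

theorem smoothing_ne (τ : Fin L.n → Fin 3) (x) : L.smoothing τ x ≠ x := by
  rcases x with ⟨c, k⟩ | q
  · exact fun h => pairing_ne (τ c) k (Prod.ext_iff.1 (Sum.inl_injective h)).2
  · exact fun h => L.turn_ne q (Sum.inr_injective h)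

theorem split_eq_smoothing (σ : L.State) :
    L.split σ = L.smoothing fun c => if σ c then 0 else 1 := by
  funext x
  rcases x with ⟨c, k⟩ | q
  · cases h : σ c <;> simp [split, smoothing, pairing, h]
  · rfl

open Classical in
/-- The parity of the number of states with a single circle depends only on whether the diagram
has a single component. -/
theorem card_single_circle_states :
    ((Finset.univ.filter fun σ : L.State => L.numCircles σ = 1).card : ZMod 2) =
      if numClasses (Linked L.edge (L.smoothing fun _ => 2)) = 1 then 1 else 0 := by
  have := L.finite_point
  rw [← sum_bool_eq_of_sum_three fun τ =>
    if numClasses (Linked L.edge (L.smoothing τ)) = 1 then 1 else 0]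
  · rw [Finset.card_filter, Nat.cast_sum]
    refine Finset.sum_congr rfl fun σ _ => ?_
    rw [← split_eq_smoothing, Nat.cast_ite, Nat.cast_one, Nat.cast_zero]
    rfl
  -- Only the four half-edges at `c` change their partner when `τ c` varies.
  · intro τ c
    refine sum_pairing_connected (a := fun k => .inl (c, k)) L.edge_invol L.edge_ne ?_
      (fun t => L.smoothing_invol _) (fun t => L.smoothing_ne _) ?_ ?_
    · exact fun k l h => (Prod.ext_iff.1 (Sum.inl_injective h)).2
    · intro t k
      simp [smoothing]
    · rintro t u (⟨d, k⟩ | q) hx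
      · have hd : d ≠ c := by
          rintro rfl
          exact hx ⟨k, rfl⟩
        simp [smoothing, hd]
      · rfl

theorem exp_pi_div_four_sq : Complex.exp (Complex.I * Real.pi / 4) ^ 2 = Complex.I := by
  rw [← Complex.exp_nat_mul]
  convert Complex.exp_pi_div_two_mul_I using 2
  push_cast
  ring

/-- The loop value is zero, so `0 ^ (d - 1)` kills every state with `d ≠ 1`. -/
theorem bracket₈_eq_sum_single_circle :
    L.bracket₈ = ∑ σ : L.State with L.numCircles σ = 1,
      Complex.exp (Complex.I * Real.pi / 4) ^ (Finset.univ.filter fun c => σ c = true).card *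
        (Complex.exp (Complex.I * Real.pi / 4))⁻¹ ^
          (Finset.univ.filter fun c => σ c = false).card := by
  have h0 : -Complex.exp (Complex.I * Real.pi / 4) ^ 2 -
      (Complex.exp (Complex.I * Real.pi / 4))⁻¹ ^ 2 = 0 := by
    rw [inv_pow, exp_pi_div_four_sq, Complex.inv_I]
    ring
  rw [bracket₈, bracket, h0, Finset.sum_filter]
  refine Finset.sum_congr rfl fun σ _ => ?_
  split_ifs with h
  · simp [h]
  -- This includes `d = 0`, the empty diagram: its exponent is `-1`, and `0 ^ (-1) = 0` by
  -- convention.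
  · rw [zero_zpow _ (by omega), mul_zero]

/-- If a multiple of the bracket by an eighth root of unity is an integer, its parity tells whether
the diagram has a single component. -/
theorem even_of_eq_mul_bracket₈
    (hL : numClasses (Linked L.edge (L.smoothing fun _ => 2)) ≠ 1) {w : ℂ} (hw : w ^ 8 = 1)
    {m : ℤ} (hm : (m : ℂ) = w * L.bracket₈) : m ≡ 0 [ZMOD 2] := by
  have hA : Complex.exp (Complex.I * Real.pi / 4) ^ 8 = 1 := by
    rw [show 8 = 2 * 4 by norm_num, pow_mul, exp_pi_div_four_sq, Complex.I_pow_four]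
  rw [bracket₈_eq_sum_single_circle, Finset.mul_sum] at hm
  have h := intCast_eq_card_of_sum_rootsOfUnity _ _ (fun σ _ => ?_) m hm
  · rw [card_single_circle_states, if_neg hL] at h
    exact (ZMod.intCast_eq_intCast_iff m 0 2).1 (by rw [h, Int.cast_zero])
  · rw [mul_pow, mul_pow, ← pow_mul, ← pow_mul, mul_comm _ 8, mul_comm _ 8, pow_mul, pow_mul,
      inv_pow, hw, hA]
    simp

end LinkDiagram

/-! ### Closed components in the closures -/

namespace SphericalTangleDiagram

/-- A closed component of `S` stays separate from the other components in each closure. -/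
theorem closure_numClasses_ne_one (S : SphericalTangleDiagram) (hS : S.HasClosedComponent)
    (i j : Fin 2) :
    numClasses (Linked (S.closure i j).edge ((S.closure i j).smoothing fun _ => 2)) ≠ 1 := by
  obtain ⟨x, hx⟩ := hS
  have : Nonempty (HalfEdge (S.closure i j).n (S.closure i j).Point) := ⟨x⟩
  rw [Ne, numClasses_eq_one_iff]
  intro h
  -- The closed component contains no end point, so the caps do not act on it and it remains a union
  -- of classes in the closure. Were there a single class, it would contain the end point `(0, 0)`.
  refine hx 0 0 ((Linked.mem_iff (S.closure i j).edge_invol ((S.closure i j).smoothing_invol _)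
    (C := fun y => EqvGen S.StrandNext x y)
    (fun y hy => .trans _ _ _ hy (.rel _ _ (.inl rfl))) (fun y hy => ?_)
    (h x (.inr (.inr (0, 0))))).1 (.refl _))
  rcases y with ⟨c, k⟩ | q | ⟨b, k⟩
  · exact .trans _ _ _ hy (.rel _ _ (.inr (.inl ⟨c, k, rfl, rfl⟩)))
  · exact .trans _ _ _ hy (.rel _ _ (.inr (.inr ⟨q, rfl, rfl⟩)))
  · exact absurd hy (hx b k)

end SphericalTangleDiagram

theorem theorem4p33 (S : SphericalTangleDiagram) (hS : S.HasClosedComponent)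
    (α β γ δ : ℤ) (hF : !![α, γ; β, δ] ∈ S.F) :
    α ≡ 0 [ZMOD 2] ∧ β ≡ 0 [ZMOD 2] ∧ γ ≡ 0 [ZMOD 2] ∧ δ ≡ 0 [ZMOD 2] := by
  obtain ⟨z, hz, h⟩ := hF
  -- The factors `±i` in the matrix are eighth roots of unity and are absorbed, together with `z`,
  -- into the multiplier `w` of the bracket.
  have hI : Complex.I ^ 8 = 1 := by
    rw [show 8 = 4 * 2 by norm_num, pow_mul, Complex.I_pow_four, one_pow]
  have hnI : (-Complex.I) ^ 8 = 1 := by rw [Even.neg_pow (by decide), hI]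
  have entry : ∀ i j, ((!![α, γ; β, δ] i j : ℤ) : ℂ) = z * S.bracketMatrix i j := fun i j =>
    congrFun (congrFun h i) j
  refine ⟨(S.closure 0 0).even_of_eq_mul_bracket₈ (S.closure_numClasses_ne_one hS 0 0) hz
      (entry 0 0),
    (S.closure 1 0).even_of_eq_mul_bracket₈ (S.closure_numClasses_ne_one hS 1 0)
      (w := z * Complex.I) ?_ ((entry 1 0).trans (mul_assoc _ _ _).symm),
    (S.closure 0 1).even_of_eq_mul_bracket₈ (S.closure_numClasses_ne_one hS 0 1)
      (w := z * -Complex.I) ?_ ((entry 0 1).trans (mul_assoc _ _ _).symm),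
    (S.closure 1 1).even_of_eq_mul_bracket₈ (S.closure_numClasses_ne_one hS 1 1)
      (w := z * (-Complex.I * Complex.I)) ?_ ((entry 1 1).trans (mul_assoc _ _ _).symm)⟩
  · rw [mul_pow, hz, hI, one_mul]
  · rw [mul_pow, hz, hnI, one_mul]
  · rw [mul_pow, mul_pow, hz, hnI, hI, one_mul, one_mul]
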